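/- Let $m>0$ and $\kappa_1,\kappa_2\ge 0$. A gamma process with scale $\kappa>0$ and rate $m>0$ is a process $\{\gamma_t\}_{t\ge0}$ with independent increments such that $\gamma_0=0$ and, for $t>0$, $\gamma_t$ has density $u^{mt-1}e^{-u/\kappa}/(\kappa^{mt}\Gamma(mt))$ on $u>0$. Let $\{\gamma_{1,t}\}$ and $\{\gamma_{2,t}\}$ be independent gamma processes with scale $1$ and rate $m$, and put $U_t=\kappa_1\gamma_{1,t}-\kappa_2\gamma_{2,t}$. Let $\{\Gamma_t\}$ be a gamma process with scale $\kappa_\Gamma>0$ and rate $m_\Gamma>0$, let $\{W_u\}_{u\ge0}$ be a standard Brownian motion independent of $\{\Gamma_t\}$, let $\mu,\sigma\in\mathbb{R}$, and put $V_t=\mu\Gamma_t+\sigma W_{\Gamma_t}$ (the processes $U$ and $V$ may live on different probability spaces). Then the following hold. 1. For all $t\ge0$ and all real $\lambda$ with $\kappa_1\lambda<1$ and $-\kappa_2\lambda<1$, the variable $e^{\lambda U_t}$ is integrable and $$\mathbb{E}\left[e^{\lambda U_t}\right]=(1-\kappa_1\lambda)^{-mt}(1+\kappa_2\lambda)^{-mt}=\left(1-(\kappa_1-\kappa_2)\lambda-\kappa_1\kappa_2\lambda^2\right)^{-mt}.$$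 2. For all $t\ge0$ and all real $\lambda$ with $\kappa_\Gamma\mu\lambda+\tfrac12\kappa_\Gamma\sigma^2\lambda^2<1$, the variable $e^{\lambda V_t}$ is integrable and $$\mathbb{E}\left[e^{\lambda V_t}\right]=\left(1-\kappa_\Gamma\mu\lambda-\tfrac12\kappa_\Gamma\sigma^2\lambda^2\right)^{-m_\Gamma t}.$$ 3. If $m_\Gamma=m$, $\kappa_\Gamma\mu=\kappa_1-\kappa_2$ and $\tfrac12\kappa_\Gamma\sigma^2=\kappa_1\kappa_2$, then the processes $\{U_t\}_{t\ge0}$ and $\{V_t\}_{t\ge0}$ are identical in law, that is, they have the same finite-dimensional distributions. 4. If $\mathbb{E}[\Gamma_t]=t$ for all $t\ge 0$, then $\kappa_\Gamma m_\Gamma=1$. If moreover $m_\Gamma=m$, $\mu=(\kappa_1-\kappa_2)m$ and $\sigma^2=2\kappa_1\kappa_2m$, then $\{U_t\}_{t\ge0}$ and $\{V_t\}_{t\ge0}$ are identical in law, and $$\kappa_1=\frac{1}{2m}\left(\mu+\sqrt{\mu^2+2\sigma^2m}\right),\qquad \kappa_2=\frac{1}{2m}\left(-\mu+\sqrt{\mu^2+2\sigma^2m}\right).$$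 -/

import Mathlib

open MeasureTheory ProbabilityTheory
open scoped NNReal

/-- `γ` is a gamma process with scale parameter `κ` and rate parameter `m` (so with growth rate
`κ * m` and variance rate `κ ^ 2 * m`): it starts at zero, has independent increments, and for
`t > 0` the variable `γ t` has density `u ^ (m t - 1) exp (-u / κ) / (κ ^ (m t) Γ(m t))`, `u > 0`.
Mathlib's `gammaMeasure a r` has shape `a` and inverse scale `r`. -/
structure IsGammaProcess {Ω : Type*} {mΩ : MeasurableSpace Ω} (γ : ℝ≥0 → Ω → ℝ) (κ m : ℝ)
    (P : Measure Ω) : Prop where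
  zero : ∀ᵐ ω ∂P, γ 0 ω = 0
  indep : HasIndepIncrements γ P
  law : ∀ t : ℝ≥0, 0 < t → HasLaw (γ t) (gammaMeasure (m * t) κ⁻¹) P

/-- Two real processes, possibly on different probability spaces, are identical in law: all their
finite-dimensional distributions agree. -/
def IdenticalInLaw {Ω Ω' : Type*} {mΩ : MeasurableSpace Ω} {mΩ' : MeasurableSpace Ω'}
    (X : ℝ≥0 → Ω → ℝ) (Y : ℝ≥0 → Ω' → ℝ) (P : Measure Ω) (P' : Measure Ω') : Prop :=
  ∀ I : Finset ℝ≥0,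
    IdentDistrib (fun ω ↦ I.restrict (X · ω)) (fun ω ↦ I.restrict (Y · ω)) P P'

/-- The difference `U_t = κ₁ γ₁_t - κ₂ γ₂_t`. -/
def gammaDifference {Ω : Type*} (κ₁ κ₂ : ℝ) (γ₁ γ₂ : ℝ≥0 → Ω → ℝ) : ℝ≥0 → Ω → ℝ :=
  fun t ω ↦ κ₁ * γ₁ t ω - κ₂ * γ₂ t ω

/-- The drifted process `V_t = μ G_t + σ W_{G_t}`. The time change `G` is real-valued; for a gamma
process `G_t` is almost surely nonnegative, so the truncation `toNNReal` changes nothing. -/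
noncomputable def driftedVG {Ω : Type*} (μ σ : ℝ) (G W : ℝ≥0 → Ω → ℝ) : ℝ≥0 → Ω → ℝ :=
  fun t ω ↦ μ * G t ω + σ * W (G t ω).toNNReal ω

/-! A process started at zero with independent increments is determined in law by the laws of its
increments. By independence, the moment generating function of an increment is the quotient of those
of the two marginals. Near zero such a function determines the law, so it suffices that `U_t` and
`V_t` have equal moment generating functions near zero (`identicalInLaw_of_mgf_eventuallyEq`);
stationarity of increments need not be assumed.

For `U_t` the function is a product of two gamma factors. For `V_t`, conditioning on `Γ_t = u`
leaves the Gaussian value `exp ((μ z + σ² z² / 2) u)`, so the gamma formula applies at `μ z + σ² z²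
/ 2`. Matching parameters makes the two quadratics equal.

The delicate point is that `V` is measurable with independent increments, since `W` is evaluated at
random times. Path continuity recovers `W` from countably many coordinates, so `W` may be replaced
by an independent copy (`identDistrib_comp_indep_times`). Fubini then factors the joint
characteristic function of the increments. -/

open Filter Topology

/-! ### Moment generating functions determine laws and divide over independent increments. -/

section MomentGeneratingFunction

variable {Ω Ω' : Type*} {mΩ : MeasurableSpace Ω} {mΩ' : MeasurableSpace Ω'}
  {P : Measure Ω} {P' : Measure Ω'}

/-- Two real random variables whose moment generating functions are finite and agree near `0` have
the same law. -/
theorem identDistrib_of_mgf_eventuallyEq [IsFiniteMeasure P] [IsFiniteMeasure P']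
    {X : Ω → ℝ} {Y : Ω' → ℝ} (hX : AEMeasurable X P) (hY : AEMeasurable Y P')
    (hiX : ∀ᶠ z in 𝓝 (0 : ℝ), Integrable (fun ω ↦ Real.exp (z * X ω)) P)
    (hiY : ∀ᶠ z in 𝓝 (0 : ℝ), Integrable (fun ω ↦ Real.exp (z * Y ω)) P')
    (hXY : mgf X P =ᶠ[𝓝 0] mgf Y P') : IdentDistrib X Y P P' := by
  refine ⟨hX, hY, Measure.ext_of_charFun ?_⟩
  have h0X : (0 : ℝ) ∈ interior (integrableExpSet X P) := mem_interior_iff_mem_nhds.2 hiX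
  have h0Y : (0 : ℝ) ∈ interior (integrableExpSet Y P') := mem_interior_iff_mem_nhds.2 hiY
  set S : Set ℝ := interior (integrableExpSet X P) ∩ interior (integrableExpSet Y P')
  have hS : Convex ℝ S := convex_integrableExpSet.interior.inter convex_integrableExpSet.interior
  -- Identity theorem on a vertical strip: the strip is convex, and agreement on real points
  -- accumulating at zero suffices.
  have key : Set.EqOn (complexMGF X P) (complexMGF Y P') {z | z.re ∈ S} := by
    refine AnalyticOnNhd.eqOn_of_preconnected_of_frequently_eq
      (analyticOnNhd_complexMGF.mono fun z hz ↦ hz.1)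
      (analyticOnNhd_complexMGF.mono fun z hz ↦ hz.2)
      (hS.linear_preimage Complex.reLm).isPreconnected
      (z₀ := ((0 : ℝ) : ℂ)) (by simp [S, h0X, h0Y]) ?_
    have h_real : ∃ᶠ x : ℝ in 𝓝[≠] 0, complexMGF X P x = complexMGF Y P' x := by
      refine Eventually.frequently ?_
      filter_upwards [nhdsWithin_le_nhds hXY] with x hx
      rw [complexMGF_ofReal, complexMGF_ofReal, hx]
    rw [frequently_iff_seq_forall] at h_real ⊢
    obtain ⟨xs, hx_tendsto, hx_eq⟩ := h_real
    refine ⟨fun n ↦ xs n, ?_, fun n ↦ by simp [hx_eq]⟩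
    rw [tendsto_nhdsWithin_iff] at hx_tendsto ⊢
    refine ⟨?_, by simpa using hx_tendsto.2⟩
    exact (Complex.continuous_ofReal.tendsto _).comp hx_tendsto.1
  ext t
  -- The strip contains the imaginary axis, where the complex function is the characteristic
  -- function.
  have := key (x := t * Complex.I) (by simp [S, h0X, h0Y])
  rwa [complexMGF_mul_I hX, complexMGF_mul_I hY] at this

/-- If `X` and `Y` are independent and `exp (z (X + Y))` is integrable, then so are the factors. -/
theorem ProbabilityTheory.IndepFun.integrable_exp_mul_of_add [IsProbabilityMeasure P]
    {X Y : Ω → ℝ} (h : X ⟂ᵢ[P] Y) (hX : AEMeasurable X P) (hY : AEMeasurable Y P) {z : ℝ}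
    (hi : Integrable (fun ω ↦ Real.exp (z * (X ω + Y ω))) P) :
    Integrable (fun ω ↦ Real.exp (z * X ω)) P ∧ Integrable (fun ω ↦ Real.exp (z * Y ω)) P := by
  have hind : (fun ω ↦ Real.exp (z * X ω)) ⟂ᵢ[P] (fun ω ↦ Real.exp (z * Y ω)) :=
    h.comp (φ := fun x ↦ Real.exp (z * x)) (ψ := fun x ↦ Real.exp (z * x))
      (by fun_prop) (by fun_prop)
  have hne (f : Ω → ℝ) : ¬ (fun ω ↦ Real.exp (f ω)) =ᵐ[P] 0 := fun h0 ↦ by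
    obtain ⟨ω, hω⟩ := h0.exists
    exact (Real.exp_pos _).ne' hω
  have hi' : Integrable (fun ω ↦ Real.exp (z * X ω) * Real.exp (z * Y ω)) P := by
    simpa only [mul_add, Real.exp_add] using hi
  have mX : AEStronglyMeasurable (fun ω ↦ Real.exp (z * X ω)) P :=
    (by fun_prop : AEMeasurable _ P).aestronglyMeasurable
  have mY : AEStronglyMeasurable (fun ω ↦ Real.exp (z * Y ω)) P :=
    (by fun_prop : AEMeasurable _ P).aestronglyMeasurable
  exact ⟨hind.integrable_left_of_integrable_op (· * ·) 1 one_ne_zero (by simp [enorm_mul])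
      hi' mX mY (hne _),
    hind.integrable_right_of_integrable_op (· * ·) 1 one_ne_zero (by simp [enorm_mul])
      hi' mX mY (hne _)⟩

/-- The moment generating function of an increment independent of its starting value. -/
theorem ProbabilityTheory.IndepFun.mgf_sub_eq_div [IsProbabilityMeasure P]
    {X Y : Ω → ℝ} (h : X ⟂ᵢ[P] (Y - X)) (hX : AEMeasurable X P) (hY : AEMeasurable Y P) {z : ℝ}
    (hi : Integrable (fun ω ↦ Real.exp (z * Y ω)) P) :
    Integrable (fun ω ↦ Real.exp (z * (Y - X) ω)) P ∧
      mgf (Y - X) P z = mgf Y P z / mgf X P z := by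
  have hint := h.integrable_exp_mul_of_add hX (hY.sub hX) (z := z) (by simpa using hi)
  refine ⟨hint.2, ?_⟩
  rw [eq_div_iff (mgf_pos hint.1).ne', mul_comm,
    ← h.mgf_add hint.1.aestronglyMeasurable hint.2.aestronglyMeasurable]
  simp

end MomentGeneratingFunction

/-! ### Processes with independent increments. -/

section IndependentIncrements

variable {Ω Ω' : Type*} {mΩ : MeasurableSpace Ω} {mΩ' : MeasurableSpace Ω'}
  {P : Measure Ω} {P' : Measure Ω'}

/-- The sum of two families of independent variables, the families being independent of each
other, is a family of independent variables. -/
theorem ProbabilityTheory.iIndepFun.add_of_indepFun {ι : Type*} [Fintype ι] {X Y : ι → Ω → ℝ}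
    (hX : iIndepFun X P) (hY : iIndepFun Y P)
    (mX : ∀ i, AEMeasurable (X i) P) (mY : ∀ i, AEMeasurable (Y i) P)
    (hXY : (fun ω i ↦ X i ω) ⟂ᵢ[P] (fun ω i ↦ Y i ω)) :
    iIndepFun (fun i ω ↦ X i ω + Y i ω) P := by
  have := hX.isProbabilityMeasure
  rw [iIndepFun_iff_charFun_pi (X := fun i ω ↦ X i ω + Y i ω) (fun i ↦ (mX i).add (mY i))]
  rw [iIndepFun_iff_charFun_pi mX] at hX
  rw [iIndepFun_iff_charFun_pi mY] at hY
  have mt : Measurable (WithLp.toLp 2 : (ι → ℝ) → EuclideanSpace ℝ ι) := by fun_prop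
  have hsum : charFun (P.map (fun ω ↦ WithLp.toLp 2 (fun i ↦ X i ω + Y i ω)))
      = charFun (P.map (fun ω ↦ WithLp.toLp 2 (X · ω)))
        * charFun (P.map (fun ω ↦ WithLp.toLp 2 (Y · ω))) :=
    (hXY.comp mt mt).charFun_map_fun_add_eq_mul
      (mt.comp_aemeasurable (aemeasurable_pi_lambda _ mX))
      (mt.comp_aemeasurable (aemeasurable_pi_lambda _ mY))
  intro t
  rw [hsum, Pi.mul_apply, hX, hY, ← Finset.prod_mul_distrib]
  refine Finset.prod_congr rfl fun i _ ↦ ?_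
  have hi : X i ⟂ᵢ[P] Y i := hXY.comp (measurable_pi_apply i) (measurable_pi_apply i)
  rw [hi.charFun_map_fun_add_eq_mul (mX i) (mY i), Pi.mul_apply]

theorem exists_monotone_nat_zero_mem_range (I : Finset ℝ≥0) :
    ∃ t : ℕ → ℝ≥0, Monotone t ∧ t 0 = 0 ∧ ∀ i ∈ I, ∃ k, t k = i := by
  classical
  set J := insert 0 I
  have hJ : 0 < J.card := Finset.card_pos.2 ⟨0, Finset.mem_insert_self _ _⟩
  -- Enumerate `I ∪ {0}` in increasing order and stay at the last point forever.
  refine ⟨fun k ↦ J.orderEmbOfFin rfl ⟨min k (J.card - 1), by omega⟩, fun a b hab ↦ ?_, ?_,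
    fun i hi ↦ ?_⟩
  · refine (J.orderEmbOfFin rfl).monotone ?_
    simp only [Fin.mk_le_mk]
    omega
  · simp only [zero_min]
    rw [Finset.orderEmbOfFin_zero rfl hJ]
    exact le_antisymm (Finset.min'_le _ _ (Finset.mem_insert_self _ _)) zero_le
  · have : i ∈ Set.range (J.orderEmbOfFin rfl) := by
      rw [Finset.range_orderEmbOfFin]
      exact Finset.mem_insert_of_mem hi
    obtain ⟨k, hk⟩ := this
    refine ⟨k, ?_⟩
    rw [← hk]
    exact congrArg (J.orderEmbOfFin rfl) (Fin.ext (by have := k.2; simp only; omega))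

/-- Two processes started at zero with independent increments are identical in law as soon as
their increments are. -/
theorem identicalInLaw_of_identDistrib_increments {X : ℝ≥0 → Ω → ℝ} {Y : ℝ≥0 → Ω' → ℝ}
    (hX : HasIndepIncrements X P) (hY : HasIndepIncrements Y P')
    (hX0 : ∀ᵐ ω ∂P, X 0 ω = 0) (hY0 : ∀ᵐ ω ∂P', Y 0 ω = 0)
    (h : ∀ s t, s ≤ t → IdentDistrib (X t - X s) (Y t - Y s) P P') :
    IdenticalInLaw X Y P P' := by
  intro I
  obtain ⟨t, ht, ht0, hI⟩ := exists_monotone_nat_zero_mem_range I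
  choose! k hk using hI
  have hpi : IdentDistrib (fun ω i ↦ X (t (i + 1)) ω - X (t i) ω)
      (fun ω i ↦ Y (t (i + 1)) ω - Y (t i) ω) P P' :=
    IdentDistrib.pi (fun i ↦ h _ _ (ht (Nat.le_succ i))) (hX.nat ht) (hY.nat ht)
  -- As the process starts at zero, its values are partial sums of the increments, by telescoping.
  have hu : Measurable (fun (d : ℕ → ℝ) (i : I) ↦ ∑ j ∈ Finset.range (k i), d j) := by fun_prop
  have hcomp := hpi.comp hu
  have sum_eq (x : ℝ≥0 → ℝ) (h0 : x 0 = 0) :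
      (fun i : I ↦ ∑ j ∈ Finset.range (k i), (x (t (j + 1)) - x (t j))) = I.restrict x := by
    ext i
    rw [Finset.sum_range_sub (fun j ↦ x (t j)), ht0, h0, hk i i.2, sub_zero]
    rfl
  have hXe : _ =ᵐ[P] fun ω ↦ I.restrict (X · ω) := hX0.mono fun ω hω ↦ sum_eq (X · ω) hω
  have hYe : _ =ᵐ[P'] fun ω ↦ I.restrict (Y · ω) := hY0.mono fun ω hω ↦ sum_eq (Y · ω) hω
  exact ((IdentDistrib.of_ae_eq hcomp.aemeasurable_fst hXe).symm.trans hcomp).trans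
    (IdentDistrib.of_ae_eq hcomp.aemeasurable_snd hYe)

/-- Two processes started at zero with independent increments are identical in law as soon as
their one-dimensional moment generating functions are finite and agree near zero. -/
theorem identicalInLaw_of_mgf_eventuallyEq [IsProbabilityMeasure P] [IsProbabilityMeasure P']
    {X : ℝ≥0 → Ω → ℝ} {Y : ℝ≥0 → Ω' → ℝ}
    (hX : HasIndepIncrements X P) (hY : HasIndepIncrements Y P')
    (mX : ∀ t, AEMeasurable (X t) P) (mY : ∀ t, AEMeasurable (Y t) P')
    (hX0 : ∀ᵐ ω ∂P, X 0 ω = 0) (hY0 : ∀ᵐ ω ∂P', Y 0 ω = 0)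
    (hiX : ∀ t, ∀ᶠ z in 𝓝 (0 : ℝ), Integrable (fun ω ↦ Real.exp (z * X t ω)) P)
    (hiY : ∀ t, ∀ᶠ z in 𝓝 (0 : ℝ), Integrable (fun ω ↦ Real.exp (z * Y t ω)) P')
    (hXY : ∀ t, mgf (X t) P =ᶠ[𝓝 0] mgf (Y t) P') :
    IdenticalInLaw X Y P P' := by
  refine identicalInLaw_of_identDistrib_increments hX hY hX0 hY0 fun s t hst ↦ ?_
  have indX := hX.indepFun_eval_sub zero_le hst hX0
  have indY := hY.indepFun_eval_sub zero_le hst hY0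
  refine identDistrib_of_mgf_eventuallyEq ((mX t).sub (mX s)) ((mY t).sub (mY s)) ?_ ?_ ?_
  · filter_upwards [hiX t] with z hz using (indX.mgf_sub_eq_div (mX s) (mX t) hz).1
  · filter_upwards [hiY t] with z hz using (indY.mgf_sub_eq_div (mY s) (mY t) hz).1
  · filter_upwards [hiX t, hiY t, hXY s, hXY t] with z hz hz' hs ht
    rw [(indX.mgf_sub_eq_div (mX s) (mX t) hz).2, (indY.mgf_sub_eq_div (mY s) (mY t) hz').2, hs, ht]

end IndependentIncrements

/-! ### The gamma distribution. -/

section GammaMeasure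

variable {a r z : ℝ}

/-- Exponential tilting stays within the gamma family; integrability and the moment generating
function follow because the tilted density has mass one. -/
theorem exp_mul_mul_gammaPDFReal (hr : 0 < r) (hz : z < r) (x : ℝ) :
    Real.exp (z * x) * gammaPDFReal a r x
      = (1 - z / r) ^ (-a) * gammaPDFReal a (r - z) x := by
  have hrz : 0 < r - z := sub_pos.2 hz
  unfold gammaPDFReal
  split_ifs
  · have h1 : (1 - z / r) ^ (-a) = r ^ a / (r - z) ^ a := by
      rw [one_sub_div hr.ne', Real.rpow_neg (by positivity), Real.div_rpow hrz.le hr.le, inv_div]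
    have h2 : Real.exp (-((r - z) * x)) = Real.exp (z * x) * Real.exp (-(r * x)) := by
      rw [← Real.exp_add]; ring_nf
    have h3 : (r - z) ^ a ≠ 0 := (Real.rpow_pos_of_pos hrz a).ne'
    rw [h1, h2]
    field_simp
  · simp

theorem integrable_gammaPDFReal (ha : 0 < a) (hr : 0 < r) : Integrable (gammaPDFReal a r) := by
  refine ⟨by fun_prop, ?_⟩
  rw [hasFiniteIntegral_iff_ofReal (ae_of_all _ (gammaPDFReal_nonneg ha hr))]
  exact (lintegral_gammaPDF_eq_one ha hr).trans_lt ENNReal.one_lt_top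

theorem integral_gammaPDFReal (ha : 0 < a) (hr : 0 < r) : ∫ x, gammaPDFReal a r x = 1 := by
  rw [integral_eq_lintegral_of_nonneg_ae (ae_of_all _ (gammaPDFReal_nonneg ha hr)) (by fun_prop)]
  have := lintegral_gammaPDF_eq_one ha hr
  simp only [gammaPDF] at this
  simp [this]

theorem integrable_exp_mul_gammaMeasure (ha : 0 < a) (hr : 0 < r) (hz : z < r) :
    Integrable (fun x ↦ Real.exp (z * x)) (gammaMeasure a r) := by
  unfold gammaMeasure
  rw [integrable_withDensity_iff (by unfold gammaPDF; fun_prop) (by simp [gammaPDF])]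
  refine ((integrable_gammaPDFReal ha (sub_pos.2 hz)).const_mul ((1 - z / r) ^ (-a))).congr
    (ae_of_all _ fun x ↦ ?_)
  simp only [gammaPDF, ENNReal.toReal_ofReal (gammaPDFReal_nonneg ha hr x)]
  exact (exp_mul_mul_gammaPDFReal hr hz x).symm

theorem mgf_gammaMeasure (ha : 0 < a) (hr : 0 < r) (hz : z < r) :
    mgf id (gammaMeasure a r) z = (1 - z / r) ^ (-a) := by
  unfold mgf gammaMeasure
  rw [integral_withDensity_eq_integral_toReal_smul (by unfold gammaPDF; fun_prop)
    (by simp [gammaPDF])]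
  simp only [gammaPDF, ENNReal.toReal_ofReal (gammaPDFReal_nonneg ha hr _), smul_eq_mul, id]
  simp_rw [mul_comm (gammaPDFReal a r _), exp_mul_mul_gammaPDFReal hr hz]
  rw [integral_const_mul, integral_gammaPDFReal ha (sub_pos.2 hz), mul_one]

theorem ae_nonneg_gammaMeasure : ∀ᵐ x ∂gammaMeasure a r, 0 ≤ x := by
  unfold gammaMeasure
  rw [ae_withDensity_iff (by unfold gammaPDF; fun_prop)]
  refine ae_of_all _ fun x hx ↦ ?_
  by_contra h
  exact hx (gammaPDF_of_neg (not_le.1 h))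

end GammaMeasure

theorem eventually_mul_lt_one (c : ℝ) : ∀ᶠ z in 𝓝 (0 : ℝ), c * z < 1 :=
  ContinuousAt.eventually_lt (f := fun z ↦ c * z) (by fun_prop) continuousAt_const (by simp)

/-! ### Gamma processes: marginals, monotonicity and mean. -/

namespace IsGammaProcess

variable {Ω : Type*} {mΩ : MeasurableSpace Ω} {P : Measure Ω}
  {γ : ℝ≥0 → Ω → ℝ} {κ m : ℝ}

theorem aemeasurable (h : IsGammaProcess γ κ m P) (t : ℝ≥0) : AEMeasurable (γ t) P := by
  rcases eq_or_ne t 0 with rfl | ht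
  · exact (aemeasurable_const (b := (0 : ℝ))).congr (h.zero.mono fun _ hω ↦ hω.symm)
  · exact (h.law t (pos_iff_ne_zero.2 ht)).aemeasurable

theorem ae_nonneg (h : IsGammaProcess γ κ m P) (t : ℝ≥0) : ∀ᵐ ω ∂P, 0 ≤ γ t ω := by
  rcases eq_or_ne t 0 with rfl | ht
  · exact h.zero.mono fun _ hω ↦ hω.ge
  · have hl := h.law t (pos_iff_ne_zero.2 ht)
    refine ae_of_ae_map (p := fun x ↦ 0 ≤ x) hl.aemeasurable ?_
    rw [hl.map_eq]
    exact ae_nonneg_gammaMeasure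

theorem integrable_exp_mul [IsProbabilityMeasure P] (h : IsGammaProcess γ κ m P) (hκ : 0 < κ) (hm : 0 < m) (t : ℝ≥0)
    {z : ℝ} (hz : κ * z < 1) : Integrable (fun ω ↦ Real.exp (z * γ t ω)) P := by
  rcases eq_or_ne t 0 with rfl | ht
  · refine (integrable_const (1 : ℝ)).congr (h.zero.mono fun ω hω ↦ ?_)
    simp [hω]
  · have ht' := pos_iff_ne_zero.2 ht
    have hl := h.law t ht'
    have hz' : z < κ⁻¹ := by rwa [← one_div, lt_div_iff₀' hκ]
    have := integrable_exp_mul_gammaMeasure (a := m * t) (by positivity) (inv_pos.2 hκ) hz'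
    rw [← hl.map_eq] at this
    exact this.comp_aemeasurable hl.aemeasurable

theorem mgf_eq [IsProbabilityMeasure P] (h : IsGammaProcess γ κ m P) (hκ : 0 < κ) (hm : 0 < m) (t : ℝ≥0)
    {z : ℝ} (hz : κ * z < 1) : mgf (γ t) P z = (1 - κ * z) ^ (-(m * t)) := by
  rcases eq_or_ne t 0 with rfl | ht
  · have : γ 0 =ᵐ[P] 0 := h.zero
    simp [mgf_congr this, mgf_zero_fun]
  · have ht' := pos_iff_ne_zero.2 ht
    have hl := h.law t ht'
    have hz' : z < κ⁻¹ := by rwa [← one_div, lt_div_iff₀' hκ]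
    rw [← mgf_id_map hl.aemeasurable, hl.map_eq,
      mgf_gammaMeasure (by positivity) (inv_pos.2 hκ) hz', div_inv_eq_mul, mul_comm z]

/-- The increments of a gamma process are nonnegative. -/
theorem ae_mono [IsProbabilityMeasure P] (h : IsGammaProcess γ κ m P) (hκ : 0 < κ) (hm : 0 < m) {s t : ℝ≥0}
    (hst : s ≤ t) : ∀ᵐ ω ∂P, γ s ω ≤ γ t ω := by
  -- Stationarity: the quotient of the two powers is the power with exponent `-(m * (t - s))`.
  have hd : IdentDistrib (γ (t - s)) (γ t - γ s) P P := by
    have ind := h.indep.indepFun_eval_sub zero_le hst h.zero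
    refine identDistrib_of_mgf_eventuallyEq (h.aemeasurable _)
      ((h.aemeasurable t).sub (h.aemeasurable s)) ?_ ?_ ?_
    · filter_upwards [eventually_mul_lt_one κ] with z hz using h.integrable_exp_mul hκ hm _ hz
    · filter_upwards [eventually_mul_lt_one κ] with z hz using
        (ind.mgf_sub_eq_div (h.aemeasurable s) (h.aemeasurable t)
          (h.integrable_exp_mul hκ hm _ hz)).1
    · filter_upwards [eventually_mul_lt_one κ] with z hz
      rw [(ind.mgf_sub_eq_div (h.aemeasurable s) (h.aemeasurable t)
          (h.integrable_exp_mul hκ hm _ hz)).2, h.mgf_eq hκ hm _ hz, h.mgf_eq hκ hm _ hz,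
        h.mgf_eq hκ hm _ hz, ← Real.rpow_sub (sub_pos.2 hz), NNReal.coe_sub hst]
      ring_nf
  filter_upwards [hd.ae_snd (p := fun x ↦ 0 ≤ x) measurableSet_Ici (h.ae_nonneg _)] with ω hω
  exact sub_nonneg.1 hω

theorem integral_eq [IsProbabilityMeasure P] (h : IsGammaProcess γ κ m P) (hκ : 0 < κ) (hm : 0 < m) (t : ℝ≥0) :
    ∫ ω, γ t ω ∂P = κ * m * t := by
  have h0 : (0 : ℝ) ∈ interior (integrableExpSet (γ t) P) := by
    refine mem_interior_iff_mem_nhds.2 ?_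
    filter_upwards [eventually_mul_lt_one κ] with z hz using h.integrable_exp_mul hκ hm _ hz
  rw [← deriv_mgf_zero h0]
  have he : mgf (γ t) P =ᶠ[𝓝 0] fun z ↦ (1 - κ * z) ^ (-(m * t)) := by
    filter_upwards [eventually_mul_lt_one κ] with z hz using h.mgf_eq hκ hm _ hz
  rw [he.deriv_eq]
  have hd : HasDerivAt (fun z : ℝ ↦ 1 - κ * z) (-κ) 0 := by
    simpa using ((hasDerivAt_id (0 : ℝ)).const_mul κ).const_sub 1
  rw [(hd.rpow_const (p := -(m * t)) (by simp)).deriv]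
  simp
  ring

end IsGammaProcess

/-! ### Evaluation of a continuous process at independent random times. -/

section Subordination

variable {Ω : Type*} {mΩ : MeasurableSpace Ω} {P : Measure Ω}

/-- Evaluation at time `u` of the continuous path with values `w (n, k)` at the times
`k / n`. -/
noncomputable def evalFromGrid (w : ℕ × ℕ → ℝ) (u : ℝ≥0) : ℝ :=
  limsup (fun n : ℕ ↦ w (n, ⌊(u : ℝ) * n⌋₊)) atTop

/-- Joint measurability in path and time holds because the limsup is over a sequence and each term
reads a coordinate with a countable index. -/
theorem measurable_evalFromGrid :
    Measurable (fun p : (ℕ × ℕ → ℝ) × ℝ≥0 ↦ evalFromGrid p.1 p.2) := by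
  refine Measurable.limsup fun n ↦ ?_
  have h1 : Measurable (fun p : (ℕ × ℕ → ℝ) × ℕ ↦ p.1 (n, p.2)) :=
    measurable_from_prod_countable_left fun k ↦ measurable_pi_apply (n, k)
  exact h1.comp (measurable_fst.prodMk
    (Nat.measurable_floor.comp (measurable_snd.coe_nnreal_real.mul_const (n : ℝ))))

theorem evalFromGrid_of_continuous {x : ℝ≥0 → ℝ} (hx : Continuous x) (u : ℝ≥0) :
    evalFromGrid (fun p ↦ x ((p.2 : ℝ≥0) / (p.1 : ℝ≥0))) u = x u := by
  have hu : Tendsto (fun n : ℕ ↦ (⌊(u : ℝ) * n⌋₊ : ℝ≥0) / (n : ℝ≥0)) atTop (𝓝 u) := by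
    rw [← NNReal.tendsto_coe]
    push_cast
    exact (tendsto_nat_floor_mul_div_atTop u.2).comp tendsto_natCast_atTop_atTop
  exact ((hx.tendsto u).comp hu).limsup_eq

attribute [irreducible] evalFromGrid

/-- A process with continuous paths evaluated at random times independent of it: the times may be
taken on another probability space. -/
theorem identDistrib_comp_indep_times [IsProbabilityMeasure P] {ι : Type*} [Countable ι]
    {W : ℝ≥0 → Ω → ℝ} (mW : ∀ t, AEMeasurable (W t) P) (cW : ∀ᵐ ω ∂P, Continuous (W · ω))
    {T : Ω → ι → ℝ≥0} (mT : AEMeasurable T P) (hTW : T ⟂ᵢ[P] (fun ω t ↦ W t ω)) :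
    IdentDistrib (fun ω ↦ (T ω, fun i ↦ W (T ω i) ω))
      (fun p : Ω × Ω ↦ (T p.1, fun i ↦ W (T p.1 i) p.2)) P (P.prod P) := by
  -- Only countably many coordinates are kept, so `w` is an a.e. measurable random element although
  -- `W` has uncountably many.
  let w : Ω → ℕ × ℕ → ℝ := fun ω p ↦ W ((p.2 : ℝ≥0) / (p.1 : ℝ≥0)) ω
  have mw : AEMeasurable w P := aemeasurable_pi_lambda _ fun _ ↦ mW _
  have hTw : T ⟂ᵢ[P] w := hTW.comp (φ := id) (ψ := fun (x : ℝ≥0 → ℝ) (p : ℕ × ℕ) ↦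
    x ((p.2 : ℝ≥0) / (p.1 : ℝ≥0))) measurable_id (by fun_prop)
  have hT : IdentDistrib T (fun p : Ω × Ω ↦ T p.1) P (P.prod P) :=
    (HasLaw.mk mT rfl).identDistrib
      ((HasLaw.mk mT rfl : HasLaw T (P.map T) P).fun_comp measurePreserving_fst.hasLaw)
  have hw : IdentDistrib w (fun p : Ω × Ω ↦ w p.2) P (P.prod P) :=
    (HasLaw.mk mw rfl).identDistrib
      ((HasLaw.mk mw rfl : HasLaw w (P.map w) P).fun_comp measurePreserving_snd.hasLaw)
  have hF : Measurable (fun q : (ι → ℝ≥0) × (ℕ × ℕ → ℝ) ↦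
      (q.1, fun i ↦ evalFromGrid q.2 (q.1 i))) := by
    refine measurable_fst.prodMk (measurable_pi_lambda _ fun i ↦ ?_)
    have hi : Measurable (fun q : (ι → ℝ≥0) × (ℕ × ℕ → ℝ) ↦ (q.2, q.1 i)) := by fun_prop
    exact measurable_evalFromGrid.comp hi
  have h := (hT.prodMk hw hTw (indepFun_prod₀ mT mw)).comp hF
  have e1 : ∀ᵐ ω ∂P, ∀ u, evalFromGrid (w ω) u = W u ω :=
    cW.mono fun ω hω u ↦ evalFromGrid_of_continuous hω u
  have e2 : ∀ᵐ p ∂P.prod P, ∀ u, evalFromGrid (w p.2) u = W u p.2 :=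
    Measure.quasiMeasurePreserving_snd.ae e1
  have f1 : (fun ω ↦ (T ω, fun i ↦ evalFromGrid (w ω) (T ω i))) =ᵐ[P]
      (fun ω ↦ (T ω, fun i ↦ W (T ω i) ω)) :=
    e1.mono fun ω hω ↦ by simp only [hω]
  have f2 : (fun p : Ω × Ω ↦ (T p.1, fun i ↦ evalFromGrid (w p.2) (T p.1 i))) =ᵐ[P.prod P]
      (fun p ↦ (T p.1, fun i ↦ W (T p.1 i) p.2)) :=
    e2.mono fun p hp ↦ by simp only [hp]
  exact ((IdentDistrib.of_ae_eq h.aemeasurable_fst f1).symm.trans h).trans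
    (IdentDistrib.of_ae_eq h.aemeasurable_snd f2)

/-- The characteristic function of the increments of a drifted Brownian motion. -/
theorem ProbabilityTheory.IsPreBrownianReal.integral_cexp_sum_increments
    {W : ℝ≥0 → Ω → ℝ} (hW : IsPreBrownianReal W P) (μ σ : ℝ) {n : ℕ} (θ : Fin n → ℝ)
    {τ : Fin (n + 1) → ℝ≥0} (hτ : Monotone τ) :
    ∫ ω, Complex.exp (∑ i, θ i * (μ * ((τ i.succ : ℝ) - τ i.castSucc)
        + σ * (W (τ i.succ) ω - W (τ i.castSucc) ω) : ℝ) * Complex.I) ∂P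
      = ∏ i, Complex.exp ((θ i * μ * Complex.I - θ i ^ 2 * σ ^ 2 / 2)
        * ((τ i.succ : ℝ) - τ i.castSucc : ℝ)) := by
  have hcf (i : Fin n) : ∫ ω, Complex.exp ((θ i * μ * ((τ i.succ : ℝ) - τ i.castSucc) : ℝ)
        * Complex.I + (θ i * σ : ℝ) * (W (τ i.succ) ω - W (τ i.castSucc) ω : ℝ) * Complex.I) ∂P
      = Complex.exp ((θ i * μ * Complex.I - θ i ^ 2 * σ ^ 2 / 2)
        * ((τ i.succ : ℝ) - τ i.castSucc : ℝ)) := by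
    have hl := hW.hasLaw_sub (τ i.succ) (τ i.castSucc)
    have hc := charFun_apply_real (μ := P.map (W (τ i.succ) - W (τ i.castSucc))) (θ i * σ)
    rw [hl.map_eq, charFun_gaussianReal, ← hl.map_eq,
      integral_map hl.aemeasurable (by fun_prop)] at hc
    have hd : ((nndist (τ i.succ).1 (τ i.castSucc).1 : ℝ≥0) : ℝ)
        = (τ i.succ : ℝ) - τ i.castSucc := by
      rw [coe_nndist, Real.dist_eq, abs_of_nonneg]
      · rfl
      · exact sub_nonneg.2 (NNReal.coe_le_coe.2 (hτ i.castSucc_lt_succ.le))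
    have hd' : ((nndist (τ i.succ).1 (τ i.castSucc).1 : ℝ≥0) : ℂ)
        = ((τ i.succ : ℝ) - τ i.castSucc : ℝ) := by rw [← hd]
    simp_rw [Complex.exp_add]
    rw [integral_const_mul]
    simp only [Pi.sub_apply] at hc
    rw [← hc, hd', ← Complex.exp_add]
    congr 1
    push_cast
    ring
  rw [← Finset.prod_congr rfl fun i _ ↦ hcf i,
    ← (hW.hasIndepIncrements n τ hτ).integral_fun_prod_comp
      (f := fun i x ↦ Complex.exp ((θ i * μ * ((τ i.succ : ℝ) - τ i.castSucc) : ℝ)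
        * Complex.I + (θ i * σ : ℝ) * (x : ℝ) * Complex.I))
      (fun i ↦ (hW.aemeasurable _).sub (hW.aemeasurable _)) (fun i ↦ by fun_prop)]
  refine integral_congr_ae (ae_of_all _ fun ω ↦ ?_)
  simp only [← Complex.exp_sum]
  congr 1
  refine Finset.sum_congr rfl fun i _ ↦ ?_
  push_cast
  ring

end Subordination

/-! ### The difference of two gamma processes. -/

section GammaDifference

variable {Ω : Type*} {mΩ : MeasurableSpace Ω} {P : Measure Ω} {γ₁ γ₂ : ℝ≥0 → Ω → ℝ} {m : ℝ}

theorem aemeasurable_gammaDifference (h₁ : IsGammaProcess γ₁ 1 m P)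
    (h₂ : IsGammaProcess γ₂ 1 m P) (κ₁ κ₂ : ℝ) (t : ℝ≥0) :
    AEMeasurable (gammaDifference κ₁ κ₂ γ₁ γ₂ t) P :=
  ((h₁.aemeasurable t).const_mul κ₁).sub ((h₂.aemeasurable t).const_mul κ₂)

theorem gammaDifference_zero_ae (h₁ : IsGammaProcess γ₁ 1 m P)
    (h₂ : IsGammaProcess γ₂ 1 m P) (κ₁ κ₂ : ℝ) :
    ∀ᵐ ω ∂P, gammaDifference κ₁ κ₂ γ₁ γ₂ 0 ω = 0 := by
  filter_upwards [h₁.zero, h₂.zero] with ω a b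
  simp [gammaDifference, a, b]

theorem hasIndepIncrements_gammaDifference (h₁ : IsGammaProcess γ₁ 1 m P)
    (h₂ : IsGammaProcess γ₂ 1 m P) (h : IndepFun (fun ω t ↦ γ₁ t ω) (fun ω t ↦ γ₂ t ω) P)
    (κ₁ κ₂ : ℝ) : HasIndepIncrements (gammaDifference κ₁ κ₂ γ₁ γ₂) P := by
  intro n t ht
  have i₁ := (h₁.indep n t ht).comp (fun _ x ↦ κ₁ * x) (by fun_prop)
  have i₂ := (h₂.indep n t ht).comp (fun _ x ↦ -κ₂ * x) (by fun_prop)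
  have ind := h.comp
    (φ := fun (x : ℝ≥0 → ℝ) (i : Fin n) ↦ κ₁ * (x (t i.succ) - x (t i.castSucc)))
    (ψ := fun (x : ℝ≥0 → ℝ) (i : Fin n) ↦ -κ₂ * (x (t i.succ) - x (t i.castSucc)))
    (by fun_prop) (by fun_prop)
  have hs := i₁.add_of_indepFun i₂
    (fun i ↦ ((h₁.aemeasurable _).sub (h₁.aemeasurable _)).const_mul κ₁)
    (fun i ↦ ((h₂.aemeasurable _).sub (h₂.aemeasurable _)).const_mul (-κ₂)) ind
  convert hs using 3 with i ω
  simp only [gammaDifference, Function.comp]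
  ring

theorem mgf_gammaDifference [IsProbabilityMeasure P] (h₁ : IsGammaProcess γ₁ 1 m P)
    (h₂ : IsGammaProcess γ₂ 1 m P) (h : IndepFun (fun ω t ↦ γ₁ t ω) (fun ω t ↦ γ₂ t ω) P)
    (hm : 0 < m) {κ₁ κ₂ : ℝ} (t : ℝ≥0) {z : ℝ} (hz₁ : κ₁ * z < 1) (hz₂ : -κ₂ * z < 1) :
    Integrable (fun ω ↦ Real.exp (z * gammaDifference κ₁ κ₂ γ₁ γ₂ t ω)) P ∧
      mgf (gammaDifference κ₁ κ₂ γ₁ γ₂ t) P z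
        = (1 - κ₁ * z) ^ (-(m * t)) * (1 + κ₂ * z) ^ (-(m * t)) := by
  have hz₁' : 1 * (κ₁ * z) < 1 := by simpa using hz₁
  have hz₂' : 1 * (-κ₂ * z) < 1 := by simpa using hz₂
  have i₁ := h₁.integrable_exp_mul one_pos hm t hz₁'
  have i₂ := h₂.integrable_exp_mul one_pos hm t hz₂'
  have ind : (fun ω ↦ κ₁ * γ₁ t ω) ⟂ᵢ[P] (fun ω ↦ -κ₂ * γ₂ t ω) :=
    h.comp (φ := fun x : ℝ≥0 → ℝ ↦ κ₁ * x t) (ψ := fun x : ℝ≥0 → ℝ ↦ -κ₂ * x t)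
      (by fun_prop) (by fun_prop)
  have j₁ : Integrable (fun ω ↦ Real.exp (z * (κ₁ * γ₁ t ω))) P := by
    convert i₁ using 3
    ring
  have j₂ : Integrable (fun ω ↦ Real.exp (z * (-κ₂ * γ₂ t ω))) P := by
    convert i₂ using 3
    ring
  have e : gammaDifference κ₁ κ₂ γ₁ γ₂ t
      = (fun ω ↦ κ₁ * γ₁ t ω) + (fun ω ↦ -κ₂ * γ₂ t ω) := by
    ext ω
    simp only [gammaDifference, Pi.add_apply]
    ring
  rw [e]
  refine ⟨ind.integrable_exp_mul_add j₁ j₂, ?_⟩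
  rw [ind.mgf_add j₁.aestronglyMeasurable j₂.aestronglyMeasurable, mgf_const_mul, mgf_const_mul,
    h₁.mgf_eq one_pos hm t hz₁', h₂.mgf_eq one_pos hm t hz₂']
  ring_nf

end GammaDifference

/-! ### The drifted, time-changed Brownian motion. -/

section DriftedVG

variable {Ω : Type*} {mΩ : MeasurableSpace Ω} {P : Measure Ω} {G W : ℝ≥0 → Ω → ℝ}
  {κ m : ℝ}

theorem identDistrib_toNNReal_comp [IsProbabilityMeasure P]
    (hG : IsGammaProcess G κ m P) (hW : IsBrownianReal W P)
    (hGW : IndepFun (fun ω t ↦ G t ω) (fun ω t ↦ W t ω) P) {ι : Type*} [Countable ι]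
    (t : ι → ℝ≥0) :
    IdentDistrib (fun ω ↦ (fun i ↦ (G (t i) ω).toNNReal, fun i ↦ W (G (t i) ω).toNNReal ω))
      (fun p : Ω × Ω ↦
        (fun i ↦ (G (t i) p.1).toNNReal, fun i ↦ W (G (t i) p.1).toNNReal p.2)) P (P.prod P) :=
  identDistrib_comp_indep_times (T := fun ω i ↦ (G (t i) ω).toNNReal) hW.aemeasurable hW.cont
    (aemeasurable_pi_lambda _ fun i ↦ (hG.aemeasurable (t i)).real_toNNReal)
    (hGW.comp (φ := fun (x : ℝ≥0 → ℝ) (i : ι) ↦ (x (t i)).toNNReal) (ψ := id)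
      (measurable_pi_lambda _ fun i ↦ (measurable_pi_apply (t i)).real_toNNReal) measurable_id)

theorem aemeasurable_driftedVG [IsProbabilityMeasure P]
    (hG : IsGammaProcess G κ m P) (hW : IsBrownianReal W P)
    (hGW : IndepFun (fun ω t ↦ G t ω) (fun ω t ↦ W t ω) P) (μ σ : ℝ) (t : ℝ≥0) :
    AEMeasurable (driftedVG μ σ G W t) P := by
  have h := (identDistrib_toNNReal_comp hG hW hGW (fun _ : Unit ↦ t)).aemeasurable_fst
  have hW' : AEMeasurable (fun ω ↦ W (G t ω).toNNReal ω) P :=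
    Measurable.comp_aemeasurable (g := fun q : (Unit → ℝ≥0) × (Unit → ℝ) ↦ q.2 ())
      (by fun_prop) h
  exact ((hG.aemeasurable t).const_mul μ).add (hW'.const_mul σ)

theorem driftedVG_zero_ae (hG : IsGammaProcess G κ m P) (hW : IsBrownianReal W P) (μ σ : ℝ) :
    ∀ᵐ ω ∂P, driftedVG μ σ G W 0 ω = 0 := by
  filter_upwards [hG.zero, hW.eval_zero_ae_eq_zero] with ω a b
  simp [driftedVG, a, b]

theorem mgf_driftedVG [IsProbabilityMeasure P]
    (hG : IsGammaProcess G κ m P) (hW : IsBrownianReal W P)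
    (hGW : IndepFun (fun ω t ↦ G t ω) (fun ω t ↦ W t ω) P) (hκ : 0 < κ) (hm : 0 < m) {μ σ : ℝ}
    (t : ℝ≥0) {z : ℝ} (hz : κ * μ * z + 1 / 2 * κ * σ ^ 2 * z ^ 2 < 1) :
    Integrable (fun ω ↦ Real.exp (z * driftedVG μ σ G W t ω)) P ∧
      mgf (driftedVG μ σ G W t) P z
        = (1 - κ * μ * z - 1 / 2 * κ * σ ^ 2 * z ^ 2) ^ (-(m * t)) := by
  -- The Laplace exponent of `μ u + σ W_u`; the hypothesis on `z` says exactly `κ * c < 1`.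
  set c : ℝ := μ * z + σ ^ 2 * z ^ 2 / 2 with hc
  have hκc : κ * c < 1 := by rw [hc]; linarith
  have hid := (identDistrib_toNNReal_comp hG hW hGW (fun _ : Unit ↦ t)).comp
    (u := fun q : (Unit → ℝ≥0) × (Unit → ℝ) ↦ Real.exp (z * (μ * q.1 () + σ * q.2 ())))
    (by fun_prop)
  have hfst : (fun ω ↦ Real.exp (z * (μ * (G t ω).toNNReal + σ * W (G t ω).toNNReal ω)))
      =ᵐ[P] fun ω ↦ Real.exp (z * driftedVG μ σ G W t ω) := by
    filter_upwards [hG.ae_nonneg t] with ω hω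
    simp only [driftedVG, Real.coe_toNNReal _ hω]
  have hgauss (u : ℝ≥0) : Integrable (fun ω ↦ Real.exp (z * (μ * u + σ * W u ω))) P ∧
      ∫ ω, Real.exp (z * (μ * u + σ * W u ω)) ∂P = Real.exp (c * u) := by
    have hl := hW.hasLaw_eval u
    have hi := integrable_exp_mul_gaussianReal (μ := 0) (v := u) (z * σ)
    rw [← hl.map_eq] at hi
    have hi' : Integrable (fun ω ↦ Real.exp (z * μ * u) * Real.exp (z * σ * W u ω)) P :=
      (hi.comp_aemeasurable hl.aemeasurable).const_mul _
    have e (ω : Ω) : Real.exp (z * (μ * u + σ * W u ω))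
        = Real.exp (z * μ * u) * Real.exp (z * σ * W u ω) := by
      rw [← Real.exp_add]
      ring_nf
    simp_rw [e]
    refine ⟨hi', ?_⟩
    rw [integral_const_mul]
    have hmgf := mgf_gaussianReal hl.map_eq (z * σ)
    rw [mgf] at hmgf
    rw [hmgf, ← Real.exp_add, hc]
    ring_nf
  have hGi := hG.integrable_exp_mul hκ hm t hκc
  have hGe : (fun ω ↦ Real.exp (c * (G t ω).toNNReal)) =ᵐ[P] fun ω ↦ Real.exp (c * G t ω) := by
    filter_upwards [hG.ae_nonneg t] with ω hω
    rw [Real.coe_toNNReal _ hω]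
  have hprod : Integrable (fun p : Ω × Ω ↦
      Real.exp (z * (μ * (G t p.1).toNNReal + σ * W (G t p.1).toNNReal p.2))) (P.prod P) := by
    refine (integrable_prod_iff hid.aemeasurable_snd.aestronglyMeasurable).2
      ⟨ae_of_all _ fun ω ↦ (hgauss (G t ω).toNNReal).1, ?_⟩
    simp only [Function.comp, Real.norm_eq_abs, Real.abs_exp, (hgauss _).2]
    exact hGi.congr hGe.symm
  refine ⟨(hid.symm.integrable_snd hprod).congr hfst, ?_⟩
  rw [mgf, ← integral_congr_ae hfst]
  refine hid.integral_eq.trans ?_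
  refine (integral_prod _ hprod).trans ?_
  simp only [(hgauss _).2]
  rw [integral_congr_ae hGe]
  refine (hG.mgf_eq hκ hm t hκc).trans ?_
  congr 1
  rw [hc]
  ring

/-- The joint characteristic function of the increments of `driftedVG`. -/
theorem integral_cexp_increments_driftedVG [IsProbabilityMeasure P]
    (hG : IsGammaProcess G κ m P) (hW : IsBrownianReal W P)
    (hGW : IndepFun (fun ω t ↦ G t ω) (fun ω t ↦ W t ω) P) (hκ : 0 < κ) (hm : 0 < m) (μ σ : ℝ)
    {n : ℕ} {t : Fin (n + 1) → ℝ≥0} (ht : Monotone t) (θ : Fin n → ℝ) :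
    ∫ ω, Complex.exp (∑ i, θ i * (driftedVG μ σ G W (t i.succ) ω
        - driftedVG μ σ G W (t i.castSucc) ω : ℝ) * Complex.I) ∂P
      = ∏ i, ∫ ω, Complex.exp ((θ i * μ * Complex.I - θ i ^ 2 * σ ^ 2 / 2)
        * (G (t i.succ) ω - G (t i.castSucc) ω : ℝ)) ∂P := by
  have hid := (identDistrib_toNNReal_comp hG hW hGW t).comp
    (u := fun q : (Fin (n + 1) → ℝ≥0) × (Fin (n + 1) → ℝ) ↦
      Complex.exp (∑ i, θ i * (μ * ((q.1 i.succ : ℝ) - q.1 i.castSucc)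
        + σ * (q.2 i.succ - q.2 i.castSucc) : ℝ) * Complex.I))
    (by fun_prop)
  have hnn : ∀ᵐ ω ∂P, ∀ i, 0 ≤ G (t i) ω := ae_all_iff.2 fun i ↦ hG.ae_nonneg _
  -- With the first coordinate frozen, the Brownian increment formula needs ordered times.
  have hmono : ∀ᵐ ω ∂P, ∀ i : Fin n, G (t i.castSucc) ω ≤ G (t i.succ) ω :=
    ae_all_iff.2 fun i ↦ hG.ae_mono hκ hm (ht i.castSucc_lt_succ.le)
  have hint : Integrable (fun p : Ω × Ω ↦ Complex.exp (∑ i, θ i *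
      (μ * (((G (t i.succ) p.1).toNNReal : ℝ) - (G (t i.castSucc) p.1).toNNReal)
        + σ * (W (G (t i.succ) p.1).toNNReal p.2 - W (G (t i.castSucc) p.1).toNNReal p.2) : ℝ)
        * Complex.I)) (P.prod P) := by
    refine Integrable.of_bound hid.aemeasurable_snd.aestronglyMeasurable 1 (ae_of_all _ fun p ↦ ?_)
    rw [← Finset.sum_mul]
    norm_cast
    exact (Complex.norm_exp_ofReal_mul_I _).le
  have hfst : (fun ω ↦ Complex.exp (∑ i, θ i * (driftedVG μ σ G W (t i.succ) ω
        - driftedVG μ σ G W (t i.castSucc) ω : ℝ) * Complex.I))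
      =ᵐ[P] fun ω ↦ Complex.exp (∑ i, θ i *
        (μ * (((G (t i.succ) ω).toNNReal : ℝ) - (G (t i.castSucc) ω).toNNReal)
        + σ * (W (G (t i.succ) ω).toNNReal ω - W (G (t i.castSucc) ω).toNNReal ω) : ℝ)
        * Complex.I) := by
    filter_upwards [hnn] with ω hω
    simp only [driftedVG, Real.coe_toNNReal _ (hω _)]
    congr 1
    refine Finset.sum_congr rfl fun i _ ↦ ?_
    push_cast
    ring
  rw [integral_congr_ae hfst]
  refine hid.integral_eq.trans ((integral_prod _ hint).trans ?_)
  rw [← (hG.indep n t ht).integral_fun_prod_comp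
      (f := fun i x ↦ Complex.exp ((θ i * μ * Complex.I - θ i ^ 2 * σ ^ 2 / 2) * (x : ℝ)))
      (fun i ↦ (hG.aemeasurable _).sub (hG.aemeasurable _)) (fun i ↦ by fun_prop)]
  refine integral_congr_ae ?_
  filter_upwards [hnn, hmono] with ω hω hω'
  have hτ : Monotone fun i ↦ (G (t i) ω).toNNReal :=
    Fin.monotone_iff_le_succ.2 fun i ↦ Real.toNNReal_le_toNNReal (hω' i)
  refine (hW.integral_cexp_sum_increments μ σ θ hτ).trans ?_
  simp only [Real.coe_toNNReal _ (hω _)]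

theorem hasIndepIncrements_driftedVG [IsProbabilityMeasure P]
    (hG : IsGammaProcess G κ m P) (hW : IsBrownianReal W P)
    (hGW : IndepFun (fun ω t ↦ G t ω) (fun ω t ↦ W t ω) P) (hκ : 0 < κ) (hm : 0 < m)
    (μ σ : ℝ) : HasIndepIncrements (driftedVG μ σ G W) P := by
  intro n t ht
  have mV := aemeasurable_driftedVG hG hW hGW μ σ
  have mI (i : Fin n) : AEMeasurable
      (fun ω ↦ driftedVG μ σ G W (t i.succ) ω - driftedVG μ σ G W (t i.castSucc) ω) P :=
    (mV _).sub (mV _)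
  rw [iIndepFun_iff_charFun_pi mI]
  intro θ
  have mt : Measurable (WithLp.toLp 2 : (Fin n → ℝ) → EuclideanSpace ℝ (Fin n)) := by fun_prop
  have mI' : AEMeasurable (fun ω ↦ WithLp.toLp 2 (fun i : Fin n ↦
      driftedVG μ σ G W (t i.succ) ω - driftedVG μ σ G W (t i.castSucc) ω)) P :=
    mt.comp_aemeasurable (aemeasurable_pi_lambda _ mI)
  rw [charFun_apply, integral_map mI' (by fun_prop)]
  have h := integral_cexp_increments_driftedVG hG hW hGW hκ hm μ σ ht θ
  have e : ∀ x : Fin n → ℝ, ((inner ℝ (WithLp.toLp 2 x) θ : ℝ) : ℂ) * Complex.I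
      = ∑ i, θ i * (x i : ℝ) * Complex.I := fun x ↦ by
    simp [PiLp.inner_apply, Finset.sum_mul]
  simp only [e]
  rw [h]
  refine Finset.prod_congr rfl fun i _ ↦ ?_
  rw [charFun_apply_real, integral_map (mI i) (by fun_prop)]
  -- The joint formula on this two-point partition identifies each factor as the characteristic
  -- function of a single increment.
  have hti : Monotone ![t i.castSucc, t i.succ] := by
    refine Fin.monotone_iff_le_succ.2 fun j ↦ ?_
    fin_cases j
    exact ht i.castSucc_lt_succ.le
  have hi := integral_cexp_increments_driftedVG hG hW hGW hκ hm μ σ hti (fun _ ↦ θ i)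
  simpa using hi.symm

end DriftedVG

/-! ### Matching the parameters. -/

theorem mainTheorem8
    {Ω Ω' : Type*} [MeasurableSpace Ω] [MeasurableSpace Ω']
    (P : Measure Ω) [IsProbabilityMeasure P] (P' : Measure Ω') [IsProbabilityMeasure P']
    -- the difference of two independent scaled gamma processes
    (m κ₁ κ₂ : ℝ) (hm : 0 < m) (hκ₁ : 0 ≤ κ₁) (hκ₂ : 0 ≤ κ₂)
    (γ₁ γ₂ : ℝ≥0 → Ω → ℝ)
    (hγ₁ : IsGammaProcess γ₁ 1 m P) (hγ₂ : IsGammaProcess γ₂ 1 m P)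
    (hγ : IndepFun (fun ω t ↦ γ₁ t ω) (fun ω t ↦ γ₂ t ω) P)
    -- the drifted VG process
    (κG mG μ σ : ℝ) (hκG : 0 < κG) (hmG : 0 < mG)
    (G W : ℝ≥0 → Ω' → ℝ)
    (hG : IsGammaProcess G κG mG P') (hW : IsBrownianReal W P')
    (hGW : IndepFun (fun ω t ↦ G t ω) (fun ω t ↦ W t ω) P') :
    -- moment generating function of `U_t`
    (∀ (t : ℝ≥0) (z : ℝ), κ₁ * z < 1 → -κ₂ * z < 1 →
      Integrable (fun ω ↦ Real.exp (z * gammaDifference κ₁ κ₂ γ₁ γ₂ t ω)) P ∧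
      ∫ ω, Real.exp (z * gammaDifference κ₁ κ₂ γ₁ γ₂ t ω) ∂P
        = (1 - κ₁ * z) ^ (-(m * t)) * (1 + κ₂ * z) ^ (-(m * t)) ∧
      ∫ ω, Real.exp (z * gammaDifference κ₁ κ₂ γ₁ γ₂ t ω) ∂P
        = (1 - (κ₁ - κ₂) * z - κ₁ * κ₂ * z ^ 2) ^ (-(m * t))) ∧
    -- moment generating function of `V_t`
    (∀ (t : ℝ≥0) (z : ℝ), κG * μ * z + 1 / 2 * κG * σ ^ 2 * z ^ 2 < 1 →
      Integrable (fun ω ↦ Real.exp (z * driftedVG μ σ G W t ω)) P' ∧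
      ∫ ω, Real.exp (z * driftedVG μ σ G W t ω) ∂P'
        = (1 - κG * μ * z - 1 / 2 * κG * σ ^ 2 * z ^ 2) ^ (-(mG * t))) ∧
    -- the processes agree in law as soon as the parameters of these functions match
    (mG = m → κG * μ = κ₁ - κ₂ → 1 / 2 * κG * σ ^ 2 = κ₁ * κ₂ →
      IdenticalInLaw (gammaDifference κ₁ κ₂ γ₁ γ₂) (driftedVG μ σ G W) P P') ∧
    -- under the normalisation `E[G_t] = t` this gives the stated parameters
    ((∀ t : ℝ≥0, ∫ ω, G t ω ∂P' = t) →
      κG * mG = 1 ∧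
      (mG = m → μ = (κ₁ - κ₂) * m → σ ^ 2 = 2 * κ₁ * κ₂ * m →
        IdenticalInLaw (gammaDifference κ₁ κ₂ γ₁ γ₂) (driftedVG μ σ G W) P P' ∧
        κ₁ = 1 / (2 * m) * (μ + √(μ ^ 2 + 2 * σ ^ 2 * m)) ∧
        κ₂ = 1 / (2 * m) * (-μ + √(μ ^ 2 + 2 * σ ^ 2 * m)))) := by
  have hU (t : ℝ≥0) (z : ℝ) (h₁ : κ₁ * z < 1) (h₂ : -κ₂ * z < 1) :
      mgf (gammaDifference κ₁ κ₂ γ₁ γ₂ t) P z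
        = (1 - (κ₁ - κ₂) * z - κ₁ * κ₂ * z ^ 2) ^ (-(m * t)) := by
    rw [(mgf_gammaDifference hγ₁ hγ₂ hγ hm t h₁ h₂).2,
      ← Real.mul_rpow (by linarith) (by linarith)]
    ring_nf
  have hlaw : mG = m → κG * μ = κ₁ - κ₂ → 1 / 2 * κG * σ ^ 2 = κ₁ * κ₂ →
      IdenticalInLaw (gammaDifference κ₁ κ₂ γ₁ γ₂) (driftedVG μ σ G W) P P' := by
    intro hmm hμ hσ
    have ev₁ := eventually_mul_lt_one κ₁
    have ev₂ := eventually_mul_lt_one (-κ₂)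
    have ev₃ : ∀ᶠ z in 𝓝 (0 : ℝ), κG * μ * z + 1 / 2 * κG * σ ^ 2 * z ^ 2 < 1 :=
      ContinuousAt.eventually_lt (f := fun z ↦ κG * μ * z + 1 / 2 * κG * σ ^ 2 * z ^ 2)
        (by fun_prop) continuousAt_const (by simp)
    refine identicalInLaw_of_mgf_eventuallyEq
      (hasIndepIncrements_gammaDifference hγ₁ hγ₂ hγ κ₁ κ₂)
      (hasIndepIncrements_driftedVG hG hW hGW hκG hmG μ σ)
      (aemeasurable_gammaDifference hγ₁ hγ₂ κ₁ κ₂)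
      (aemeasurable_driftedVG hG hW hGW μ σ)
      (gammaDifference_zero_ae hγ₁ hγ₂ κ₁ κ₂) (driftedVG_zero_ae hG hW μ σ) ?_ ?_ ?_
    · intro t
      filter_upwards [ev₁, ev₂] with z h₁ h₂ using
        (mgf_gammaDifference hγ₁ hγ₂ hγ hm t h₁ h₂).1
    · intro t
      filter_upwards [ev₃] with z h₃ using (mgf_driftedVG hG hW hGW hκG hmG t h₃).1
    · intro t
      filter_upwards [ev₁, ev₂, ev₃] with z h₁ h₂ h₃
      rw [hU t z h₁ h₂, (mgf_driftedVG hG hW hGW hκG hmG t h₃).2, hmm, hμ, hσ]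
  refine ⟨fun t z h₁ h₂ ↦ ?_, fun t z hz ↦ mgf_driftedVG hG hW hGW hκG hmG t hz, hlaw,
    fun hmean ↦ ?_⟩
  · have h := mgf_gammaDifference hγ₁ hγ₂ hγ hm t h₁ h₂
    exact ⟨h.1, h.2, hU t z h₁ h₂⟩
  have hκm : κG * mG = 1 := by
    have h := hG.integral_eq hκG hmG 1
    rw [hmean 1] at h
    simpa using h.symm
  refine ⟨hκm, fun hmm hμ hσ ↦ ⟨hlaw hmm ?_ ?_, ?_⟩⟩
  · rw [hμ, ← hmm]
    linear_combination (κ₁ - κ₂) * hκm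
  · rw [hσ, ← hmm]
    linear_combination κ₁ * κ₂ * hκm
  -- Here `(κ₁ - κ₂)² + 4 κ₁ κ₂ = (κ₁ + κ₂)²`, and nonnegativity of the scales selects the positive
  -- root.
  · have hs : √(μ ^ 2 + 2 * σ ^ 2 * m) = (κ₁ + κ₂) * m := by
      have e : μ ^ 2 + 2 * σ ^ 2 * m = ((κ₁ + κ₂) * m) ^ 2 := by
        rw [hσ, hμ]
        ring
      rw [e, Real.sqrt_sq (by positivity)]
    rw [hs, hμ]
    constructor <;> field_simp <;> ring
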